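/- Let $n\ge 0$, let $\bar\kappa\in\{-1,0,1\}$, and let $\mathbb M^{n+1}(\bar\kappa)$ be $\mathbb R^{n+1}$ if $\bar\kappa=0$, the unit sphere $\mathbb S^{n+1}\subset\mathbb R^{n+2}$ if $\bar\kappa=1$, and hyperbolic space $\mathbb H^{n+1}=\{p:\langle p,p\rangle=-1,\ p_0>0\}$ in the Lorentzian space $\mathbb L^{n+2}$ if $\bar\kappa=-1$. Let $(c,s)=(1,\xi)$, $(\cos\xi,\sin\xi)$, $(\cosh\xi,\sinh\xi)$ for $\bar\kappa=0,1,-1$ respectively. Let $F:M^n\to\mathbb M^{n+1}(\bar\kappa)$ be a connected smooth immersed hypersurface, oriented by a smooth unit normal vector field $N$ (tangent to $\mathbb M^{n+1}(\bar\kappa)$). Its principal curvatures $\kappa_1,\dots,\kappa_n$ are the eigenvalues of $h(v,w)=-\langle dN(v),dF(w)\rangle$ with respect to the induced metric $g(v,w)=\langle dF(v),dF(w)\rangle$, and $H=\sum_i\kappa_i$ is its mean curvature. $F$ is isoparametric if its principal curvatures are constant on $M$, and minimal if $H\equiv0$. Say that $F$ is the initial data of a solution to the mean curvature flow by parallel hypersurfaces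 if there are a nondegenerate interval $I\subset\mathbb R$ with $0\in I$, a function $\xi:I\to\mathbb R$ with $\xi(0)=0$, and immersed hypersurfaces $\widehat F^t:M\to\mathbb M^{n+1}(\bar\kappa)$, $t\in I$, such that $\widehat F^0=F$ and, for all $x\in M$ and $t\in I$, $$\widehat F^t(x)=c(\xi(t))F(x)+s(\xi(t))N(x),\qquad \frac{\partial}{\partial t}\widehat F^t(x)=\widehat H^t(x)\,\widehat N^t(x),$$ where $\widehat N^t$ is a smooth unit normal vector field of $\widehat F^t$ and $\widehat H^t$ is the mean curvature of $\widehat F^t$ with respect to $\widehat N^t$ (time derivatives are one-sided at endpoints of $I$ belonging to $I$). Then: 1. If $F$ is isoparametric, then $F$ is the initial data of a solution to the mean curvature flow by parallel hypersurfaces. 2. If $F$ is not minimal and is the initial data of a solution to the mean curvature flow by parallel hypersurfaces, then $F$ is isoparametric. In particular, a non-minimal $F$ is the initial data of a solution to the mean curvature flow by parallel hypersurfaces if and only if it is isoparametric. -/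

import Mathlib

open scoped Manifold ContDiff

noncomputable section

namespace SpaceForm

/-- Dimension of the vector space containing the `(n+1)`-dimensional space form of curvature
`κ ∈ {-1, 0, 1}`: it is `n + 1` for Euclidean space and `n + 2` for the sphere and for
hyperbolic space. -/
abbrev ambientDim (κ : SignType) (n : ℕ) : ℕ :=
  match κ with
  | .zero => n + 1
  | .pos => n + 2
  | .neg => n + 2

/-- The vector space `ℝ^{n+1}` (if `κ = 0`) or `ℝ^{n+2}` (if `κ = ±1`) containing the
space form. -/
abbrev Ambient (κ : SignType) (n : ℕ) : Type := EuclideanSpace ℝ (Fin (ambientDim κ n))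

/-- The scalar product of the ambient vector space: the Euclidean one if `κ = 0` or `κ = 1`, and
the Lorentzian one, `-x₀ y₀ + x₁ y₁ + ⋯ + x_{n+1} y_{n+1}`, if `κ = -1`. -/
def form (κ : SignType) {n : ℕ} (x y : Ambient κ n) : ℝ :=
  ∑ i, (if κ = -1 ∧ i.val = 0 then (-1 : ℝ) else 1) * (x i * y i)

/-- The space form of dimension `n + 1` and curvature `κ`: all of `ℝ^{n+1}` if `κ = 0`, the unit
sphere `⟨p, p⟩ = 1` if `κ = 1`, and the upper sheet `⟨p, p⟩ = -1`, `p₀ > 0` of the hyperboloid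
in Lorentzian space if `κ = -1`. -/
def space (κ : SignType) (n : ℕ) : Set (Ambient κ n) :=
  {p | (κ ≠ 0 → form κ p p = (κ : ℝ)) ∧ (κ = -1 → ∀ i, i.val = 0 → 0 < p i)}

/-- The function `c`: `1`, `cos` or `cosh` for `κ = 0, 1, -1`. -/
def c (κ : SignType) (ξ : ℝ) : ℝ :=
  match κ with
  | .zero => 1
  | .pos => Real.cos ξ
  | .neg => Real.cosh ξ

/-- The function `s`: the identity, `sin` or `sinh` for `κ = 0, 1, -1`. -/
def s (κ : SignType) (ξ : ℝ) : ℝ :=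
  match κ with
  | .zero => ξ
  | .pos => Real.sin ξ
  | .neg => Real.sinh ξ

section Hypersurface

variable {κ : SignType} {n : ℕ} {M : Type*} [TopologicalSpace M]
  [ChartedSpace (EuclideanSpace ℝ (Fin n)) M]

/-- The differential `dF(v)` of a vector-valued map at `x`, as a vector of the ambient space. -/
def diff (F : M → Ambient κ n) (x : M) (v : TangentSpace (𝓡 n) x) : Ambient κ n :=
  mfderiv (𝓡 n) 𝓘(ℝ, Ambient κ n) F x v

/-- `F : M → M^{n+1}(κ)` is an immersed hypersurface: a smooth map with values in the space form
whose differential is injective at every point. -/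
structure IsHypersurface (F : M → Ambient κ n) : Prop where
  smooth : ContMDiff (𝓡 n) 𝓘(ℝ, Ambient κ n) ∞ F
  mem_space : ∀ x, F x ∈ space κ n
  immersion : ∀ x, Function.Injective (diff F x)

/-- `N` is a smooth unit normal vector field along the hypersurface `F` of the space form: it is
tangent to the space form (that is, `⟨N, F⟩ = 0` unless `κ = 0`), of length one, and orthogonal to
the image of `dF`. -/
structure IsUnitNormal (F N : M → Ambient κ n) : Prop where
  smooth : ContMDiff (𝓡 n) 𝓘(ℝ, Ambient κ n) ∞ N
  tangent : κ ≠ 0 → ∀ x, form κ (N x) (F x) = 0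
  unit : ∀ x, form κ (N x) (N x) = 1
  normal : ∀ x v, form κ (N x) (diff F x v) = 0

/-- The induced metric `g(v, w) = ⟨dF(v), dF(w)⟩`. -/
def metric (F : M → Ambient κ n) (x : M) (v w : TangentSpace (𝓡 n) x) : ℝ :=
  form κ (diff F x v) (diff F x w)

/-- The second fundamental form `h(v, w) = -⟨dN(v), dF(w)⟩`. -/
def secondForm (F N : M → Ambient κ n) (x : M) (v w : TangentSpace (𝓡 n) x) : ℝ :=
  -form κ (diff N x v) (diff F x w)

/-- `k 0, …, k (n-1)` are the principal curvatures, repeated according to multiplicity, of the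
hypersurface `F` with unit normal field `N` at the point `x`: there are tangent vectors
`e 0, …, e (n-1)` at `x` with `g(e i, e j) = δ i j` and `h(e i, e j) = k i * δ i j`. Such a family
`k` exists at every point and is unique up to order. -/
def HasPrincipalCurvatures (F N : M → Ambient κ n) (x : M) (k : Fin n → ℝ) : Prop :=
  ∃ e : Fin n → TangentSpace (𝓡 n) x,
    (∀ i j, metric F x (e i) (e j) = if i = j then 1 else 0) ∧
    (∀ i j, secondForm F N x (e i) (e j) = if i = j then k i else 0)

/-- `H` is the mean curvature (the sum of the principal curvatures) of the hypersurface `F` with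
unit normal field `N` at the point `x`. -/
def HasMeanCurvature (F N : M → Ambient κ n) (x : M) (H : ℝ) : Prop :=
  ∃ k : Fin n → ℝ, HasPrincipalCurvatures F N x k ∧ H = ∑ i, k i

/-- The principal curvatures do not depend on the point. -/
def IsIsoparametric (F N : M → Ambient κ n) : Prop :=
  ∃ k : Fin n → ℝ, ∀ x, HasPrincipalCurvatures F N x k

/-- The mean curvature vanishes identically. -/
def IsMinimal (F N : M → Ambient κ n) : Prop :=
  ∀ x, HasMeanCurvature F N x 0

/-- `G t`, for `t` in the interval `I`, is a solution to the mean curvature flow with initial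
condition `F`: every `G t` is a hypersurface, `G 0 = F`, and at each time `t ∈ I` one has
`∂G/∂t = H N`, where `N` is a unit normal field of `G t` and `H` the mean curvature with respect to
`N` (the product `H N` does not depend on the choice of `N`). The interval is nondegenerate and
contains `0`; the time derivative is one-sided at endpoints belonging to `I`. -/
structure IsMCFSolution (F : M → Ambient κ n) (I : Set ℝ) (G : ℝ → M → Ambient κ n) : Prop where
  interval : I.OrdConnected
  nondegenerate : I.Nontrivial
  zero_mem : (0 : ℝ) ∈ I
  hypersurface : ∀ t ∈ I, IsHypersurface (G t)
  initial : G 0 = F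
  evolution : ∀ t ∈ I, ∃ N : M → Ambient κ n, IsUnitNormal (G t) N ∧
    ∀ x, ∃ H : ℝ, HasMeanCurvature (G t) N x H ∧
      HasDerivWithinAt (fun τ => G τ x) (H • N x) I t

/-- `F`, with unit normal field `N`, is the initial data of a solution to the mean curvature flow
by parallel hypersurfaces `G t = c(ξ(t)) F + s(ξ(t)) N`, `t ∈ I`, with `ξ(0) = 0`. -/
def IsInitialDataOfParallelMCF (F N : M → Ambient κ n) : Prop :=
  ∃ (I : Set ℝ) (G : ℝ → M → Ambient κ n) (ξ : ℝ → ℝ),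
    IsMCFSolution F I G ∧ ξ 0 = 0 ∧
      ∀ t ∈ I, ∀ x, G t x = c κ (ξ t) • F x + s κ (ξ t) • N x

end Hypersurface

end SpaceForm

end

noncomputable section

namespace SpaceForm

/-! Rodrigues' formula makes the differentials of `c(ξ)F + s(ξ)N` and of its unit normal `c(ξ)N - κ
s(ξ)F` diagonal on a principal frame of `F`. So the parallel map is immersed exactly when no factor
`c - k i * s` vanishes, and its principal curvatures are then `(c * k i + κ s) / (c - k i * s)`. The
`ξ`-derivative of the parallel map is this unit normal.

If the `k i` are constant on `M`, the flow therefore reduces to the scalar equation `ξ' = ∑ i,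
parallelCurvature κ (k i) ξ`, `ξ 0 = 0`, which is solvable for short time.

Conversely, pairing the flow equation with the fixed vector `N x` gives `(s ∘ ξ)' = H c(ξ)`. The
left side does not involve `x`, so the mean curvature at time `t` is constant on `M` while `c(ξ t) ≠
0`. With `τ = s/c` this says that `∑ k i / (1 - k i τ)` is independent of the point. This sum is
`-P'/P` for `P = ∏ (1 - k i X)`. As `F` is not minimal, `(s ∘ ξ)'(0) ≠ 0`, so `τ` takes nonzero
values accumulating at `0`. Two such `P` then have the same logarithmic derivative, and both equal
`1` at `0`, hence they coincide. So the principal curvatures at any two points agree up to order. -/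

/-- The scalar product of the ambient space as a continuous bilinear map. -/
def formL (κ : SignType) (n : ℕ) : Ambient κ n →L[ℝ] Ambient κ n →L[ℝ] ℝ :=
  (LinearMap.mk₂ ℝ (form κ (n := n))
    (fun x y z => by
      simp only [form, ← Finset.sum_add_distrib]
      refine Finset.sum_congr rfl fun i _ => ?_
      simp only [PiLp.add_apply]; ring)
    (fun a x y => by
      simp only [form, smul_eq_mul, Finset.mul_sum]
      refine Finset.sum_congr rfl fun i _ => ?_
      simp only [PiLp.smul_apply, smul_eq_mul]; ring)
    (fun x y z => by
      simp only [form, ← Finset.sum_add_distrib]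
      refine Finset.sum_congr rfl fun i _ => ?_
      simp only [PiLp.add_apply]; ring)
    (fun a x y => by
      simp only [form, smul_eq_mul, Finset.mul_sum]
      refine Finset.sum_congr rfl fun i _ => ?_
      simp only [PiLp.smul_apply, smul_eq_mul]; ring)).toContinuousBilinearMap

/-! ### Linear algebra of the scalar product; the functions `c` and `s`. -/

section Algebra

variable {κ : SignType} {n : ℕ}

theorem formL_apply (x y : Ambient κ n) : formL κ n x y = form κ x y := rfl

theorem form_comm (x y : Ambient κ n) : form κ x y = form κ y x := by
  simp only [form, mul_comm]

theorem form_add_left (x y z : Ambient κ n) : form κ (x + y) z = form κ x z + form κ y z := by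
  simp only [← formL_apply, map_add, add_apply]

theorem form_add_right (x y z : Ambient κ n) : form κ x (y + z) = form κ x y + form κ x z := by
  simp only [← formL_apply, map_add]

theorem form_sub_left (x y z : Ambient κ n) : form κ (x - y) z = form κ x z - form κ y z := by
  simp only [← formL_apply, map_sub, sub_apply]

theorem form_smul_left (a : ℝ) (x y : Ambient κ n) : form κ (a • x) y = a * form κ x y := by
  simp only [← formL_apply, map_smul, smul_apply, smul_eq_mul]

theorem form_smul_right (a : ℝ) (x y : Ambient κ n) : form κ x (a • y) = a * form κ x y := by
  simp only [← formL_apply, map_smul, smul_eq_mul]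

theorem form_sum_left {ι : Type*} (t : Finset ι) (f : ι → Ambient κ n) (y : Ambient κ n) :
    form κ (∑ i ∈ t, f i) y = ∑ i ∈ t, form κ (f i) y := by
  simp only [← formL_apply, map_sum, sum_apply]

theorem form_sum_right {ι : Type*} (t : Finset ι) (f : ι → Ambient κ n) (y : Ambient κ n) :
    form κ y (∑ i ∈ t, f i) = ∑ i ∈ t, form κ y (f i) := by
  simp only [← formL_apply, map_sum]

theorem c_zero : c κ 0 = 1 := by
  cases κ <;> simp [c]

theorem s_zero : s κ 0 = 0 := by
  cases κ <;> simp [s]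

theorem c_sq_add_s_sq (ξ : ℝ) : c κ ξ * c κ ξ + (κ : ℝ) * (s κ ξ * s κ ξ) = 1 := by
  cases κ
  · simp [c, SignType.cast]
  · simp [c, s, SignType.cast]; nlinarith [Real.cosh_sq ξ]
  · simp [c, s, SignType.cast]; nlinarith [Real.sin_sq_add_cos_sq ξ]

theorem hasDerivAt_c (ξ : ℝ) : HasDerivAt (c κ) (-((κ : ℝ) * s κ ξ)) ξ := by
  cases κ
  · refine (hasDerivAt_const ξ (1 : ℝ)).congr_deriv ?_
    simp [SignType.cast]
  · refine (Real.hasDerivAt_cosh ξ).congr_deriv ?_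
    simp [SignType.cast, s]
  · refine (Real.hasDerivAt_cos ξ).congr_deriv ?_
    simp [SignType.cast, s]

theorem hasDerivAt_s (ξ : ℝ) : HasDerivAt (s κ) (c κ ξ) ξ := by
  cases κ
  · exact hasDerivAt_id ξ
  · exact Real.hasDerivAt_sinh ξ
  · exact Real.hasDerivAt_sin ξ

theorem contDiff_c : ContDiff ℝ 1 (c κ) := by
  cases κ
  · exact contDiff_const
  · exact Real.contDiff_cosh
  · exact Real.contDiff_cos

theorem contDiff_s : ContDiff ℝ 1 (s κ) := by
  cases κ
  · exact contDiff_id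
  · exact Real.contDiff_sinh
  · exact Real.contDiff_sin

theorem cast_mul_self_of_ne_zero (h : κ ≠ 0) : (κ : ℝ) * κ = 1 := by
  cases κ <;> simp_all [SignType.cast]

theorem c_eq_one_of_eq_zero (h : κ = 0) (ξ : ℝ) : c κ ξ = 1 := by
  subst h; rfl

/-- Expansion of a vector in an orthogonal family of maximal cardinality. -/
theorem _root_.LinearMap.BilinForm.sum_div_smul_eq_of_orthogonal {V ι : Type*} [AddCommGroup V]
    [Module ℝ V] [FiniteDimensional ℝ V] [Fintype ι] [DecidableEq ι]
    (B : LinearMap.BilinForm ℝ V) (b : ι → V)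
    (d : ι → ℝ) (hd : ∀ i, d i ≠ 0) (hb : ∀ i j, B (b i) (b j) = if i = j then d i else 0)
    (hcard : Fintype.card ι = Module.finrank ℝ V) (w : V) :
    w = ∑ j, (B w (b j) / d j) • b j := by
  have hli : LinearIndependent ℝ b := by
    refine LinearMap.BilinForm.linearIndependent_of_iIsOrtho (B := B) ?_ ?_
    · intro i j hij
      simpa [hij] using hb i j
    · intro i h
      exact hd i (by simpa [hb] using h)
  have hsp := hli.span_eq_top_of_card_eq_finrank' hcard
  obtain ⟨a, ha⟩ := (Submodule.mem_span_range_iff_exists_fun ℝ).1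
    (hsp ▸ Submodule.mem_top : w ∈ Submodule.span ℝ (Set.range b))
  conv_lhs => rw [← ha]
  refine Finset.sum_congr rfl fun j _ => ?_
  congr 1
  rw [← ha]
  simp [hb, hd j]

/-- A vector orthogonal to a unit normal and to the position vector (if `κ ≠ 0`) is the sum of its
components along an orthonormal tangent frame. -/
theorem eq_sum_form_smul {u : Fin n → Ambient κ n} {p q w : Ambient κ n}
    (hu : ∀ i j, form κ (u i) (u j) = if i = j then 1 else 0)
    (hq : form κ q q = 1) (hqu : ∀ i, form κ q (u i) = 0)
    (hp : κ ≠ 0 → form κ p p = (κ : ℝ) ∧ form κ q p = 0 ∧ ∀ i, form κ p (u i) = 0)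
    (hwq : form κ w q = 0) (hwp : κ ≠ 0 → form κ w p = 0) :
    w = ∑ i, form κ w (u i) • u i := by
  classical
  have huq : ∀ i, form κ (u i) q = 0 := fun i => by rw [form_comm, hqu]
  by_cases hκ : κ = 0
  · have := LinearMap.BilinForm.sum_div_smul_eq_of_orthogonal
      (LinearMap.mk₂ ℝ (form κ (n := n)) form_add_left form_smul_left form_add_right
        form_smul_right) (Sum.elim u fun _ : Unit => q) (fun _ => 1) (by simp)
      (by rintro (i | i) (j | j) <;> simp [hu, hq, hqu, huq])
      (by subst hκ; simp) w
    simpa [hwq] using this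
  · obtain ⟨hpp, hqp, hpu⟩ := hp hκ
    have hκ' : (κ : ℝ) ≠ 0 := fun h => by simpa [h] using cast_mul_self_of_ne_zero hκ
    have hup : ∀ i, form κ (u i) p = 0 := fun i => by rw [form_comm, hpu]
    have hpq : form κ p q = 0 := by rw [form_comm, hqp]
    have := LinearMap.BilinForm.sum_div_smul_eq_of_orthogonal
      (LinearMap.mk₂ ℝ (form κ (n := n)) form_add_left form_smul_left form_add_right
        form_smul_right) (Sum.elim u (Sum.elim (fun _ : Unit => q) fun _ : Unit => p))
      (Sum.elim (fun _ => 1) (Sum.elim (fun _ => 1) fun _ => (κ : ℝ)))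
      (by rintro (i | i | i) <;> simp [hκ'])
      (by rintro (i | i | i) (j | j | j) <;> simp [hu, hq, hqu, huq, hpp, hqp, hpq, hup, hpu])
      (by cases κ
          · exact absurd rfl hκ
          · simp
          · simp) w
    simpa [hwq, hwp hκ] using this

end Algebra

/-! ### Differentials of vector-valued maps. -/

section Calculus

variable {κ : SignType} {n : ℕ} {M : Type*} [TopologicalSpace M]
  [ChartedSpace (EuclideanSpace ℝ (Fin n)) M] {F N : M → Ambient κ n} {x : M}

/-- The differential as a continuous linear map between normed spaces. -/
def diffL (F : M → Ambient κ n) (x : M) : EuclideanSpace ℝ (Fin n) →L[ℝ] Ambient κ n :=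
  mfderiv (𝓡 n) 𝓘(ℝ, Ambient κ n) F x

theorem diffL_apply (v : TangentSpace (𝓡 n) x) : diffL F x v = diff F x v := rfl

theorem diff_sum_smul {ι : Type*} (t : Finset ι) (a : ι → ℝ) (e : ι → TangentSpace (𝓡 n) x) :
    diff F x (∑ i ∈ t, a i • e i) = ∑ i ∈ t, a i • diff F x (e i) :=
  (map_sum (diffL F x) _ _).trans (Finset.sum_congr rfl fun i _ => (diffL F x).map_smul (a i) (e i))

theorem diff_smul (a : ℝ) (v : TangentSpace (𝓡 n) x) : diff F x (a • v) = a • diff F x v :=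
  (diffL F x).map_smul a v

theorem diff_add (v w : TangentSpace (𝓡 n) x) : diff F x (v + w) = diff F x v + diff F x w :=
  (diffL F x).map_add v w

theorem smooth_lincomb (hF : ContMDiff (𝓡 n) 𝓘(ℝ, Ambient κ n) ∞ F)
    (hN : ContMDiff (𝓡 n) 𝓘(ℝ, Ambient κ n) ∞ N) (a b : ℝ) :
    ContMDiff (𝓡 n) 𝓘(ℝ, Ambient κ n) ∞ fun y => a • F y + b • N y :=
  (((contDiff_const_smul a (F := Ambient κ n) (n := ∞)).contMDiff.comp hF)).add
    ((contDiff_const_smul b (F := Ambient κ n) (n := ∞)).contMDiff.comp hN)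

theorem diff_lincomb (hF : ContMDiff (𝓡 n) 𝓘(ℝ, Ambient κ n) ∞ F)
    (hN : ContMDiff (𝓡 n) 𝓘(ℝ, Ambient κ n) ∞ N) (a b : ℝ) (x : M) (v : TangentSpace (𝓡 n) x) :
    diff (fun y => a • F y + b • N y) x v = a • diff F x v + b • diff N x v := by
  have h1 := ((hF x).mdifferentiableAt (by simp)).hasMFDerivAt
  have h2 := ((hN x).mdifferentiableAt (by simp)).hasMFDerivAt
  have h := ((h1.const_smul a).add (h2.const_smul b)).mfderiv
  have h' : diffL (fun y => a • F y + b • N y) x = a • diffL F x + b • diffL N x := h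
  rw [← diffL_apply, h']
  rfl

/-- Product rule for a pair of vector-valued maps with constant scalar product. -/
theorem form_diff_add_form_diff_eq_zero (hF : ContMDiff (𝓡 n) 𝓘(ℝ, Ambient κ n) ∞ F)
    (hN : ContMDiff (𝓡 n) 𝓘(ℝ, Ambient κ n) ∞ N) {r : ℝ} (h : ∀ y, form κ (F y) (N y) = r)
    (x : M) (v : TangentSpace (𝓡 n) x) :
    form κ (diff F x v) (N x) + form κ (F x) (diff N x v) = 0 := by
  have h1 : HasFDerivWithinAt (F ∘ (extChartAt (𝓡 n) x).symm) (diffL F x) (Set.range (𝓡 n))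
      (extChartAt (𝓡 n) x x) := ((hF x).mdifferentiableAt (by simp)).hasMFDerivAt.2
  have h2 : HasFDerivWithinAt (N ∘ (extChartAt (𝓡 n) x).symm) (diffL N x) (Set.range (𝓡 n))
      (extChartAt (𝓡 n) x x) := ((hN x).mdifferentiableAt (by simp)).hasMFDerivAt.2
  have h3 := (formL κ n).hasFDerivWithinAt_of_bilinear h1 h2
  have h4 := ((𝓡 n).uniqueDiffOn _ (Set.mem_range_self _)).eq h3
    ((hasFDerivWithinAt_const r _ _).congr (fun y _ => h _) (h _))
  have h5 : form κ ((F ∘ (extChartAt (𝓡 n) x).symm) (extChartAt (𝓡 n) x x)) (diff N x v) +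
      form κ (diff F x v) ((N ∘ (extChartAt (𝓡 n) x).symm) (extChartAt (𝓡 n) x x)) = 0 :=
    congrArg (fun L => L v) h4
  rw [Function.comp_apply, Function.comp_apply, extChartAt_to_inv] at h5
  rw [add_comm, h5]

end Calculus

/-! ### Principal frames and the choice of unit normal. -/

section Frames

variable {κ : SignType} {n : ℕ} {M : Type*} [TopologicalSpace M]
  [ChartedSpace (EuclideanSpace ℝ (Fin n)) M] {F N : M → Ambient κ n}

theorem IsUnitNormal.form_diff_self (hN : IsUnitNormal F N) (x : M) (v : TangentSpace (𝓡 n) x) :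
    form κ (diff N x v) (N x) = 0 := by
  have := form_diff_add_form_diff_eq_zero hN.smooth hN.smooth hN.unit x v
  rw [form_comm (N x)] at this
  linarith

theorem IsHypersurface.form_diff_self (hF : IsHypersurface F) (hκ : κ ≠ 0) (x : M)
    (v : TangentSpace (𝓡 n) x) : form κ (diff F x v) (F x) = 0 := by
  have := form_diff_add_form_diff_eq_zero hF.smooth hF.smooth
    (fun y => (hF.mem_space y).1 hκ) x v
  rw [form_comm (F x)] at this
  linarith

theorem IsUnitNormal.form_diff_position (hF : IsHypersurface F) (hN : IsUnitNormal F N)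
    (hκ : κ ≠ 0) (x : M) (v : TangentSpace (𝓡 n) x) : form κ (diff N x v) (F x) = 0 := by
  have := form_diff_add_form_diff_eq_zero hN.smooth hF.smooth (hN.tangent hκ) x v
  rwa [hN.normal, add_zero] at this

/-- A tangential vector is the sum of its components along an orthonormal frame. -/
theorem IsUnitNormal.eq_sum_form_diff_smul (hF : IsHypersurface F) (hN : IsUnitNormal F N) {x : M}
    {e : Fin n → TangentSpace (𝓡 n) x}
    (he : ∀ i j, metric F x (e i) (e j) = if i = j then 1 else 0) {w : Ambient κ n}
    (hwN : form κ w (N x) = 0) (hwF : κ ≠ 0 → form κ w (F x) = 0) :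
    w = ∑ i, form κ w (diff F x (e i)) • diff F x (e i) :=
  eq_sum_form_smul (u := fun i => diff F x (e i)) he (hN.unit x) (fun i => hN.normal x (e i))
    (fun hκ => ⟨(hF.mem_space x).1 hκ, hN.tangent hκ x, fun i => by
      rw [form_comm]; exact hF.form_diff_self hκ x (e i)⟩) hwN hwF

/-- Rodrigues' formula: `dN(e i) = -k i dF(e i)` for a frame of principal directions. -/
theorem IsUnitNormal.diff_principal (hF : IsHypersurface F) (hN : IsUnitNormal F N) {x : M}
    {e : Fin n → TangentSpace (𝓡 n) x} {k : Fin n → ℝ}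
    (he : ∀ i j, metric F x (e i) (e j) = if i = j then 1 else 0)
    (hk : ∀ i j, secondForm F N x (e i) (e j) = if i = j then k i else 0) (i : Fin n) :
    diff N x (e i) = -(k i • diff F x (e i)) := by
  have hk' : ∀ j, form κ (diff N x (e i)) (diff F x (e j)) = if i = j then -k i else 0 := by
    intro j
    have := hk i j
    unfold secondForm at this
    split_ifs at this ⊢ <;> linarith
  rw [hN.eq_sum_form_diff_smul hF he (hN.form_diff_self x (e i))
    (fun hκ => hN.form_diff_position hF hκ x (e i))]
  simp [hk']

theorem metric_add_left {x : M} (u v w : TangentSpace (𝓡 n) x) :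
    metric F x (u + v) w = metric F x u w + metric F x v w := by
  simp only [metric, diff_add, form_add_left]

theorem metric_add_right {x : M} (u v w : TangentSpace (𝓡 n) x) :
    metric F x u (v + w) = metric F x u v + metric F x u w := by
  simp only [metric, diff_add, form_add_right]

theorem metric_smul_left {x : M} (a : ℝ) (v w : TangentSpace (𝓡 n) x) :
    metric F x (a • v) w = a * metric F x v w := by
  simp only [metric, diff_smul, form_smul_left]

theorem metric_smul_right {x : M} (a : ℝ) (v w : TangentSpace (𝓡 n) x) :
    metric F x v (a • w) = a * metric F x v w := by
  simp only [metric, diff_smul, form_smul_right]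

/-- Expansion of a tangent vector in an orthonormal frame. -/
theorem eq_sum_metric_smul {x : M} {e : Fin n → TangentSpace (𝓡 n) x}
    (he : ∀ i j, metric F x (e i) (e j) = if i = j then 1 else 0) (v : TangentSpace (𝓡 n) x) :
    v = ∑ i, metric F x v (e i) • e i := by
  have := LinearMap.BilinForm.sum_div_smul_eq_of_orthogonal (V := EuclideanSpace ℝ (Fin n))
    (LinearMap.mk₂ ℝ (metric F x) metric_add_left metric_smul_left metric_add_right
        metric_smul_right) e (fun _ => 1) (by simp) he (by simp) v
  simp only [div_one] at this
  exact this

theorem secondForm_sum_smul {x : M} {ι : Type*} [Fintype ι] (e : ι → TangentSpace (𝓡 n) x)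
    (a b : ι → ℝ) :
    secondForm F N x (∑ i, a i • e i) (∑ j, b j • e j) =
      ∑ i, ∑ j, a i * b j * secondForm F N x (e i) (e j) := by
  simp only [secondForm, diff_sum_smul, form_sum_left, form_sum_right, form_smul_left,
    form_smul_right, ← Finset.sum_neg_distrib, Finset.mul_sum]
  rw [Finset.sum_comm]
  exact Finset.sum_congr rfl fun i _ => Finset.sum_congr rfl fun j _ => by ring

/-- The mean curvature is well defined. -/
theorem HasMeanCurvature.unique {x : M} {H H' : ℝ} (h : HasMeanCurvature F N x H)
    (h' : HasMeanCurvature F N x H') : H = H' := by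
  obtain ⟨k, ⟨e, he, hk⟩, rfl⟩ := h
  obtain ⟨l, ⟨f, hf, hl⟩, rfl⟩ := h'
  -- Invariance of the trace: the change of frame `A` is orthogonal, `l i` is the sum of the `A i m
  -- ^ 2 * k m`, and the columns of `A` have norm one.
  let A : Matrix (Fin n) (Fin n) ℝ := Matrix.of fun i j => metric F x (f i) (e j)
  have hfe : ∀ i, f i = ∑ j, A i j • e j := fun i => eq_sum_metric_smul he (f i)
  have hA : A * A.transpose = 1 := by
    ext i j
    rw [Matrix.mul_apply, Matrix.one_apply, ← hf i j]
    conv_rhs => rw [hfe j]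
    simp only [metric, diff_sum_smul, form_sum_right, form_smul_right, Matrix.transpose_apply]
    exact Finset.sum_congr rfl fun m _ => mul_comm _ _
  have hA' : A.transpose * A = 1 := mul_eq_one_comm.1 hA
  have hl' : ∀ i, l i = ∑ m, A i m * A i m * k m := by
    intro i
    have := hl i i
    rw [if_pos rfl, hfe i, secondForm_sum_smul] at this
    simpa [hk] using this.symm
  simp only [hl']
  rw [Finset.sum_comm]
  refine Finset.sum_congr rfl fun m _ => ?_
  have := congrFun (congrFun hA' m) m
  rw [Matrix.mul_apply, Matrix.one_apply_eq] at this
  rw [← Finset.sum_mul]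
  simp only [Matrix.transpose_apply] at this
  rw [this, one_mul]

/-- Principal curvatures with respect to another unit normal field differ by a sign. -/
theorem HasPrincipalCurvatures.exists_sign {ν : M → Ambient κ n} (hF : IsHypersurface F)
    (hN : IsUnitNormal F N) (hν : IsUnitNormal F ν)
    (hframe : ∀ y, ∃ k, HasPrincipalCurvatures F N y k) (x : M) :
    ∃ ε : ℝ, ε * ε = 1 ∧ N x = ε • ν x ∧ ∀ k, HasPrincipalCurvatures F N x k →
      HasPrincipalCurvatures F ν x (fun i => ε * k i) := by
  set η : M → ℝ := fun y => form κ (N y) (ν y) with hη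
  have hNν : ∀ y, N y = η y • ν y := by
    intro y
    obtain ⟨k, e, he, -⟩ := hframe y
    have := hν.eq_sum_form_diff_smul hF he (w := N y - η y • ν y)
      (by rw [form_sub_left, form_smul_left, hν.unit, hη]; ring)
      (fun hκ => by rw [form_sub_left, form_smul_left, hν.tangent hκ, hN.tangent hκ]; ring)
    simp only [form_sub_left, form_smul_left, hν.normal, hN.normal] at this
    simpa [sub_eq_zero] using this
  have hsq : ∀ y, η y * η y = 1 := by
    intro y
    have := hN.unit y
    rw [hNν, form_smul_left, form_smul_right, hν.unit, mul_one] at this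
    exact this
  have hcont : Continuous η := by
    have h1 : Continuous fun y => formL κ n (N y) (ν y) :=
      ((formL κ n).continuous.comp hN.smooth.continuous).clm_apply hν.smooth.continuous
    exact h1
  -- A continuous function with square `1` is locally constant, so differentiating `ν = η N`
  -- produces no term in `dη`.
  have hloc : ∀ᶠ y in nhds x, η y = η x := by
    have : ∀ᶠ y in nhds x, 0 < η y * η x :=
      (hcont.mul (continuous_const (y := η x))).continuousAt.eventually_const_lt
        (by simpa only [Pi.mul_apply, hsq] using one_pos)
    filter_upwards [this] with y hy
    have := hsq y
    have := hsq x
    have h0 : (η y - η x) * (η y + η x) = 0 := by linarith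
    rcases mul_eq_zero.1 h0 with h | h
    · linarith
    · have : η y = -η x := by linarith
      rw [this] at hy
      nlinarith
  refine ⟨η x, hsq x, hNν x, ?_⟩
  rintro k ⟨e, he, hk⟩
  have hd : ∀ v : TangentSpace (𝓡 n) x, diff ν x v = η x • diff N x v := by
    intro v
    have hev : ν =ᶠ[nhds x] fun y => η x • N y + (0 : ℝ) • N y := by
      filter_upwards [hloc] with y hy
      rw [hNν y, hy, smul_smul, hsq]
      simp
    have h1 : diffL ν x = diffL (fun y => η x • N y + (0 : ℝ) • N y) x := hev.mfderiv_eq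
    rw [← diffL_apply, h1, diffL_apply, diff_lincomb hN.smooth hN.smooth, zero_smul, add_zero]
  refine ⟨e, he, fun i j => ?_⟩
  have := hk i j
  simp only [secondForm, hd, form_smul_left] at this ⊢
  rw [← mul_neg, this]
  split_ifs <;> simp

end Frames

/-! ### Parallel hypersurfaces and their principal curvatures. -/

section ParallelMaps

variable {κ : SignType} {n : ℕ} {M : Type*}

/-- The parallel map `c(ξ) F + s(ξ) N`. -/
def parallel (F N : M → Ambient κ n) (ξ : ℝ) (x : M) : Ambient κ n := c κ ξ • F x + s κ ξ • N x

/-- The unit normal field `c(ξ) N - κ s(ξ) F` of the parallel map. -/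
def parallelNormal (F N : M → Ambient κ n) (ξ : ℝ) (x : M) : Ambient κ n :=
  (-((κ : ℝ) * s κ ξ)) • F x + c κ ξ • N x

/-- The principal curvature of a parallel hypersurface. -/
def parallelCurvature (κ : SignType) (k ξ : ℝ) : ℝ :=
  (c κ ξ * k + κ * s κ ξ) / (c κ ξ - k * s κ ξ)

theorem hasDerivAt_parallel (F N : M → Ambient κ n) (ξ : ℝ) (x : M) :
    HasDerivAt (fun r => parallel F N r x) (parallelNormal F N ξ x) ξ :=
  ((hasDerivAt_c ξ).smul_const (F x)).add ((hasDerivAt_s ξ).smul_const (N x))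

theorem parallel_zero (F N : M → Ambient κ n) : parallel F N 0 = F := by
  funext x
  simp [parallel, c_zero, s_zero]

theorem contDiffAt_parallelCurvature (k : ℝ) :
    ContDiffAt ℝ 1 (parallelCurvature κ k) 0 := by
  refine ContDiffAt.div ?_ ?_ (by simp [c_zero, s_zero])
  · exact (contDiff_c.contDiffAt.mul contDiffAt_const).add
      (contDiffAt_const.mul contDiff_s.contDiffAt)
  · exact contDiff_c.contDiffAt.sub (contDiffAt_const.mul contDiff_s.contDiffAt)

end ParallelMaps

section Parallel

variable {κ : SignType} {n : ℕ} {M : Type*} [TopologicalSpace M]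
  [ChartedSpace (EuclideanSpace ℝ (Fin n)) M] {F N : M → Ambient κ n}

theorem form_parallelNormal_normal (hN : IsUnitNormal F N) (ξ : ℝ) (x : M) :
    form κ (parallelNormal F N ξ x) (N x) = c κ ξ := by
  rw [parallelNormal, form_add_left, form_smul_left, form_smul_left, hN.unit, form_comm (F x)]
  by_cases hκ : κ = 0
  · subst hκ; simp
  · rw [hN.tangent hκ]; ring

/-- Pairing with the fixed vectors `N x` and, for `κ ≠ 0`, `F x` recovers `s κ ξ` and `c κ ξ` from
the moving point. In the converse these functions inherit their regularity in time from the flow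
this way, although `ξ` itself is not assumed continuous. -/
theorem form_parallel_normal (hN : IsUnitNormal F N) (ξ : ℝ) (x : M) :
    form κ (parallel F N ξ x) (N x) = c κ ξ * form κ (F x) (N x) + s κ ξ := by
  rw [parallel, form_add_left, form_smul_left, form_smul_left, hN.unit, mul_one]

theorem form_parallel_position (hF : IsHypersurface F) (hN : IsUnitNormal F N) (hκ : κ ≠ 0)
    (ξ : ℝ) (x : M) : form κ (parallel F N ξ x) (F x) = κ * c κ ξ := by
  rw [parallel, form_add_left, form_smul_left, form_smul_left, hN.tangent hκ,
    (hF.mem_space x).1 hκ]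
  ring

theorem diff_parallel (hF : IsHypersurface F) (hN : IsUnitNormal F N) (ξ : ℝ) (x : M)
    (v : TangentSpace (𝓡 n) x) :
    diff (parallel F N ξ) x v = c κ ξ • diff F x v + s κ ξ • diff N x v :=
  diff_lincomb hF.smooth hN.smooth _ _ x v

theorem diff_parallelNormal (hF : IsHypersurface F) (hN : IsUnitNormal F N) (ξ : ℝ) (x : M)
    (v : TangentSpace (𝓡 n) x) :
    diff (parallelNormal F N ξ) x v =
      (-((κ : ℝ) * s κ ξ)) • diff F x v + c κ ξ • diff N x v :=
  diff_lincomb hF.smooth hN.smooth _ _ x v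

theorem isUnitNormal_parallelNormal (hF : IsHypersurface F) (hN : IsUnitNormal F N) (ξ : ℝ) :
    IsUnitNormal (parallel F N ξ) (parallelNormal F N ξ) where
  smooth := smooth_lincomb hF.smooth hN.smooth _ _
  tangent hκ x := by
    simp only [parallel, parallelNormal, form_add_left, form_add_right, form_smul_left,
      form_smul_right, form_comm (F x) (N x), hN.tangent hκ, hN.unit, (hF.mem_space x).1 hκ]
    linear_combination (-s κ ξ * c κ ξ) * cast_mul_self_of_ne_zero hκ
  unit x := by
    simp only [parallelNormal, form_add_left, form_add_right, form_smul_left,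
      form_smul_right, form_comm (F x) (N x), hN.unit]
    by_cases hκ : κ = 0
    · subst hκ; simp [c_eq_one_of_eq_zero]
    · rw [hN.tangent hκ, (hF.mem_space x).1 hκ]
      linear_combination c_sq_add_s_sq (κ := κ) ξ +
        (κ * s κ ξ * s κ ξ) * cast_mul_self_of_ne_zero hκ
  normal x v := by
    rw [diff_parallel hF hN, parallelNormal]
    simp only [form_add_left, form_add_right, form_smul_left, form_smul_right, hN.normal,
      form_comm (N x) (diff N x v), hN.form_diff_self x v]
    by_cases hκ : κ = 0
    · subst hκ; simp
    · rw [form_comm, hF.form_diff_self hκ, form_comm, hN.form_diff_position hF hκ]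
      ring

theorem diff_parallel_principal (hF : IsHypersurface F) (hN : IsUnitNormal F N) (ξ : ℝ) {x : M}
    {e : Fin n → TangentSpace (𝓡 n) x} {k : Fin n → ℝ}
    (he : ∀ i j, metric F x (e i) (e j) = if i = j then 1 else 0)
    (hk : ∀ i j, secondForm F N x (e i) (e j) = if i = j then k i else 0) (i : Fin n) :
    diff (parallel F N ξ) x (e i) = (c κ ξ - k i * s κ ξ) • diff F x (e i) := by
  rw [diff_parallel hF hN, hN.diff_principal hF he hk, sub_smul, smul_neg, smul_smul,
    mul_comm (s κ ξ), sub_eq_add_neg]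

theorem diff_parallelNormal_principal (hF : IsHypersurface F) (hN : IsUnitNormal F N) (ξ : ℝ)
    {x : M} {e : Fin n → TangentSpace (𝓡 n) x} {k : Fin n → ℝ}
    (he : ∀ i j, metric F x (e i) (e j) = if i = j then 1 else 0)
    (hk : ∀ i j, secondForm F N x (e i) (e j) = if i = j then k i else 0) (i : Fin n) :
    diff (parallelNormal F N ξ) x (e i) = (-(c κ ξ * k i + κ * s κ ξ)) • diff F x (e i) := by
  rw [diff_parallelNormal hF hN, hN.diff_principal hF he hk, smul_neg, smul_smul, ← sub_eq_add_neg,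
    ← sub_smul]
  congr 1
  ring

/-- The principal directions persist; only their lengths change, by the factors `c - k i * s`, so
dividing by these restores orthonormality. -/
theorem HasPrincipalCurvatures.parallel (hF : IsHypersurface F) (hN : IsUnitNormal F N) {ξ : ℝ}
    {x : M} {k : Fin n → ℝ} (h : HasPrincipalCurvatures F N x k)
    (hξ : ∀ i, c κ ξ - k i * s κ ξ ≠ 0) :
    HasPrincipalCurvatures (parallel F N ξ) (parallelNormal F N ξ) x
      fun i => parallelCurvature κ (k i) ξ := by
  obtain ⟨e, he, hk⟩ := h
  have h1 := diff_parallel_principal hF hN ξ he hk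
  have h2 := diff_parallelNormal_principal hF hN ξ he hk
  refine ⟨fun i => (c κ ξ - k i * s κ ξ)⁻¹ • e i, fun i j => ?_, fun i j => ?_⟩
  · have := he i j
    simp only [metric] at this
    simp only [metric, diff_smul, h1, smul_smul, inv_mul_cancel₀ (hξ _), one_smul, this]
  · have := he i j
    simp only [metric] at this
    simp only [secondForm, diff_smul, h1, h2, smul_smul, inv_mul_cancel₀ (hξ _), one_smul,
      form_smul_left, this, parallelCurvature]
    split_ifs
    · field_simp [hξ i]
    · simp

theorem HasPrincipalCurvatures.parallel_injective_iff (hF : IsHypersurface F)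
    (hN : IsUnitNormal F N) {ξ : ℝ} {x : M} {k : Fin n → ℝ}
    (h : HasPrincipalCurvatures F N x k) :
    Function.Injective (diff (SpaceForm.parallel F N ξ) x) ↔ ∀ i, c κ ξ - k i * s κ ξ ≠ 0 := by
  obtain ⟨e, he, hk⟩ := h
  have h1 := diff_parallel_principal hF hN ξ he hk
  have hzero : diff (SpaceForm.parallel F N ξ) x (0 : EuclideanSpace ℝ (Fin n)) = 0 :=
    (diffL (SpaceForm.parallel F N ξ) x).map_zero
  constructor
  · intro hinj i hi
    have h2 := h1 i
    rw [hi, zero_smul, ← hzero] at h2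
    have h3 := he i i
    rw [hinj h2, if_pos rfl] at h3
    have h4 : diff F x (0 : EuclideanSpace ℝ (Fin n)) = 0 := (diffL F x).map_zero
    have h5 : form κ (diff F x (0 : EuclideanSpace ℝ (Fin n)))
      (diff F x (0 : EuclideanSpace ℝ (Fin n))) = 1 := h3
    rw [h4, ← formL_apply, map_zero] at h5
    exact zero_ne_one h5
  · intro hξ
    refine (injective_iff_map_eq_zero (diffL (SpaceForm.parallel F N ξ) x)).2 fun v hv => ?_
    have hv' : diff (SpaceForm.parallel F N ξ) x v = 0 := hv
    have h2 := eq_sum_metric_smul he v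
    set a := fun i => metric F x v (e i)
    have h3 : ∀ j, a j = 0 := by
      intro j
      have h4 : form κ (diff (SpaceForm.parallel F N ξ) x v) (diff F x (e j)) = 0 := by
        rw [hv', ← formL_apply, map_zero]; rfl
      have h5 : ∀ i, form κ (diff F x (e i)) (diff F x (e j)) = if i = j then 1 else 0 :=
        fun i => he i j
      rw [h2, diff_sum_smul] at h4
      simp only [h1, form_sum_left, form_smul_left, h5] at h4
      simpa [hξ j] using h4
    rw [h2]
    exact Finset.sum_eq_zero fun i _ => by
      change a i • e i = 0
      rw [h3]; exact zero_smul ℝ (e i)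

/-- Cauchy–Schwarz on the spatial coordinates gives `(q₀ p₀)² ≤ (1 + q₀²)(p₀² - 1)`, that is `q₀² ≤
p₀² - 1`. Together with `|sinh| < cosh` this keeps parallel maps on the upper sheet. -/
theorem abs_zero_lt_of_hyperbolic {m : ℕ} {p q : Ambient (-1) m}
    (hp : form (-1) p p = -1) (hp0 : 0 < p (0 : Fin (m + 2))) (hq : form (-1) q q = 1)
    (hqp : form (-1) q p = 0) : |q (0 : Fin (m + 2))| < p (0 : Fin (m + 2)) := by
  have hform : ∀ x y : Ambient (-1) m, form (-1) x y =
      -(x (0 : Fin (m + 2)) * y (0 : Fin (m + 2))) +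
        ∑ i : Fin (m + 1), x (Fin.succ i : Fin (m + 2)) * y (Fin.succ i : Fin (m + 2)) := by
    intro x y
    refine (Fin.sum_univ_succ (n := m + 1) _).trans ?_
    simp
  rw [hform] at hp hq hqp
  have hcs := Finset.sum_mul_sq_le_sq_mul_sq Finset.univ
    (fun i : Fin (m + 1) => q (Fin.succ i : Fin (m + 2)))
    (fun i : Fin (m + 1) => p (Fin.succ i : Fin (m + 2)))
  simp only [pow_two] at hcs
  rw [eq_neg_add_of_add_eq hqp] at hcs
  refine abs_lt_of_sq_lt_sq ?_ hp0.le
  nlinarith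

theorem parallel_mem_space (hF : IsHypersurface F) (hN : IsUnitNormal F N) (ξ : ℝ) (x : M) :
    parallel F N ξ x ∈ space κ n := by
  constructor
  · intro hκ
    simp only [parallel, form_add_left, form_add_right, form_smul_left,
      form_smul_right, form_comm (F x) (N x), hN.tangent hκ, hN.unit, (hF.mem_space x).1 hκ]
    linear_combination (κ : ℝ) * c_sq_add_s_sq (κ := κ) ξ -
      (s κ ξ * s κ ξ) * cast_mul_self_of_ne_zero hκ
  · rintro rfl i hi
    have hi0 : i = (0 : Fin (n + 2)) := Fin.ext hi
    have hp := (hF.mem_space x).1 (by decide)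
    have hp0 := (hF.mem_space x).2 rfl (0 : Fin (n + 2)) rfl
    have hlt := abs_zero_lt_of_hyperbolic (by simpa using hp) hp0 (hN.unit x)
      (hN.tangent (by decide) x)
    subst hi0
    change 0 < Real.cosh ξ * F x (0 : Fin (n + 2)) + Real.sinh ξ * N x (0 : Fin (n + 2))
    have h1 : |Real.sinh ξ| < Real.cosh ξ :=
      abs_lt_of_sq_lt_sq (by nlinarith [Real.cosh_sq ξ]) (Real.cosh_pos ξ).le
    have h2 : |Real.sinh ξ * N x (0 : Fin (n + 2))| < Real.cosh ξ * F x (0 : Fin (n + 2)) := by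
      rw [abs_mul]
      exact mul_lt_mul'' h1 hlt (abs_nonneg _) (abs_nonneg _)
    linarith [(abs_lt.1 h2).1]

theorem isHypersurface_parallel (hF : IsHypersurface F) (hN : IsUnitNormal F N) {ξ : ℝ}
    (h : ∀ x, ∃ k, HasPrincipalCurvatures F N x k ∧ ∀ i, c κ ξ - k i * s κ ξ ≠ 0) :
    IsHypersurface (parallel F N ξ) where
  smooth := smooth_lincomb hF.smooth hN.smooth _ _
  mem_space := parallel_mem_space hF hN ξ
  immersion x := by
    obtain ⟨k, hk, hξ⟩ := h x
    exact (hk.parallel_injective_iff hF hN).2 hξ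

end Parallel

/-! ### Isoparametric hypersurfaces flow by parallels. -/

section InitialData

variable {κ : SignType} {n : ℕ} {M : Type*} [TopologicalSpace M]
  [ChartedSpace (EuclideanSpace ℝ (Fin n)) M] {F N : M → Ambient κ n}

theorem IsIsoparametric.isInitialDataOfParallelMCF (hF : IsHypersurface F)
    (hN : IsUnitNormal F N) (h : IsIsoparametric F N) : IsInitialDataOfParallelMCF F N := by
  obtain ⟨k, hk⟩ := h
  -- Picard–Lindelöf for the speed `∑ i, parallelCurvature κ (k i) ξ`, which is `C¹` near `0`
  -- because its denominators equal `1` there.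
  obtain ⟨ξ, hξ0, ε, hε, hξ⟩ :=
    (ContDiffAt.sum (s := Finset.univ) fun i _ => contDiffAt_parallelCurvature (κ := κ) (k i)
      : ContDiffAt ℝ 1 (fun r => ∑ i, parallelCurvature κ (k i) r) 0
      ).exists_forall_mem_closedBall_exists_eq_forall_mem_Ioo_hasDerivAt₀ 0
  simp only [zero_sub, zero_add] at hξ
  have hcont : ContinuousAt ξ 0 := (hξ 0 ⟨by linarith, hε⟩).continuousAt
  have hreg : ∀ᶠ t in nhds (0 : ℝ), ∀ i, c κ (ξ t) - k i * s κ (ξ t) ≠ 0 := by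
    rw [Filter.eventually_all]
    intro i
    have h1 : ContinuousAt (fun t => c κ (ξ t) - k i * s κ (ξ t)) 0 :=
      (contDiff_c.continuous.continuousAt.comp hcont).sub
        (continuousAt_const.mul (contDiff_s.continuous.continuousAt.comp hcont))
    exact h1.eventually_ne (by simp [hξ0, c_zero, s_zero])
  obtain ⟨δ, hδ, hball⟩ := Metric.eventually_nhds_iff_ball.1 hreg
  have hρ : 0 < min ε δ := lt_min hε hδ
  have hmem : ∀ t ∈ Set.Ioo (-min ε δ) (min ε δ), ∀ i, c κ (ξ t) - k i * s κ (ξ t) ≠ 0 := by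
    intro t ht
    refine hball t ?_
    rw [Metric.mem_ball, Real.dist_eq, sub_zero, abs_lt]
    exact ⟨by linarith [ht.1, min_le_right ε δ], by linarith [ht.2, min_le_right ε δ]⟩
  refine ⟨Set.Ioo (-min ε δ) (min ε δ), fun t => parallel F N (ξ t), ξ, ?_, hξ0,
    fun _ _ _ => rfl⟩
  refine ⟨Set.ordConnected_Ioo, ?_, ⟨by linarith, hρ⟩, fun t ht =>
    isHypersurface_parallel hF hN fun x => ⟨k, hk x, hmem t ht⟩, by
      simp only [hξ0, parallel_zero], fun t ht => ?_⟩
  · exact ⟨0, ⟨by linarith, hρ⟩, min ε δ / 2, ⟨by linarith, by linarith⟩, by linarith⟩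
  · refine ⟨parallelNormal F N (ξ t), isUnitNormal_parallelNormal hF hN _, fun x =>
      ⟨_, ⟨_, (hk x).parallel hF hN (hmem t ht), rfl⟩, ?_⟩⟩
    have h1 := hξ t ⟨by linarith [ht.1, min_le_left ε δ], by linarith [ht.2, min_le_left ε δ]⟩
    exact ((hasDerivAt_parallel F N (ξ t) x).scomp t h1).hasDerivWithinAt

end InitialData

end SpaceForm

/-! ### Recovering a finite family from a logarithmic derivative. -/

section Polynomials

open Polynomial

/-- A polynomial solution of the linear equation `d' p = p' d` that vanishes at a point where `p`
does not vanish is zero. -/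
theorem Polynomial.eq_zero_of_derivative_mul_eq {K : Type*} [Field K] [CharZero K] {d p : K[X]}
    {a : K} (h : derivative d * p = derivative p * d) (hd : d.IsRoot a) (hp : ¬p.IsRoot a) :
    d = 0 := by
  by_contra hd0
  have hp0 : p ≠ 0 := by rintro rfl; exact hp (by simp)
  have hm : 0 < rootMultiplicity a d := (rootMultiplicity_pos hd0).2 hd
  have hd' : derivative d ≠ 0 := by
    intro h0
    obtain ⟨b, rfl⟩ := natDegree_eq_zero.1 (derivative_eq_zero.1 h0)
    rw [IsRoot, eval_C] at hd
    exact hd0 (by rw [hd, C_0])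
  -- With `m` the multiplicity of `a` in `d`, the left side of `h` vanishes at `a` to order exactly
  -- `m - 1`, the right side to order at least `m`.
  have h1 := rootMultiplicity_mul (x := a) (mul_ne_zero hd' hp0)
  rw [derivative_rootMultiplicity_of_root hd, rootMultiplicity_eq_zero hp] at h1
  have h2 := rootMultiplicity_mul (x := a) (p := derivative p) (q := d)
    (h ▸ mul_ne_zero hd' hp0)
  rw [← h] at h2
  omega

/-- `∏ (1 - k i X)`, the polynomial whose zeros are the inverses of the numbers `k i`. -/
def focalPolynomial {ι : Type*} [Fintype ι] (k : ι → ℝ) : ℝ[X] := ∏ i, (1 - C (k i) * X)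

variable {ι : Type*} [Fintype ι]

theorem eval_focalPolynomial (k : ι → ℝ) (r : ℝ) :
    (focalPolynomial k).eval r = ∏ i, (1 - k i * r) := by
  simp [focalPolynomial, eval_prod]

theorem eval_derivative_focalPolynomial (k : ι → ℝ) {r : ℝ} (hr : ∀ i, 1 - k i * r ≠ 0) :
    (derivative (focalPolynomial k)).eval r =
      -((∏ i, (1 - k i * r)) * ∑ i, k i / (1 - k i * r)) := by
  classical
  rw [focalPolynomial, derivative_prod_finset, eval_finsetSum, Finset.mul_sum,
    ← Finset.sum_neg_distrib]
  refine Finset.sum_congr rfl fun i hi => ?_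
  rw [← Finset.mul_prod_erase _ _ hi]
  simp only [eval_mul, eval_prod, derivative_sub, derivative_one, derivative_mul, derivative_C,
    derivative_X, eval_sub, eval_one, eval_C, eval_X, zero_mul, zero_add, mul_one, zero_sub,
    eval_neg]
  linear_combination (∏ j ∈ Finset.univ.erase i, (1 - k j * r)) * div_mul_cancel₀ (k i) (hr i)

/-- Two families with the same multiset of values agree up to a permutation. -/
theorem exists_perm_of_map_univ_eq {α : Type*} {k l : ι → α}
    (h : Finset.univ.val.map k = Finset.univ.val.map l) : ∃ σ : Equiv.Perm ι, l ∘ σ = k := by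
  classical
  have hcard : ∀ a, Fintype.card {i // k i = a} = Fintype.card {i // l i = a} := by
    intro a
    have := congrArg (Multiset.count a) h
    rw [Multiset.count_map, Multiset.count_map] at this
    rw [Fintype.card_subtype, Fintype.card_subtype]
    simpa only [Finset.card_def, Finset.filter_val, eq_comm] using this
  exact ⟨Equiv.ofFiberEquiv fun a => Fintype.equivOfCardEq (hcard a),
    funext fun i => Equiv.ofFiberEquiv_map _ i⟩

/-- Reversal: `y ^ card ι * P(1/y) = ∏ (y - k i)`. Zero values of `k`, invisible among the roots of
`P`, become roots again. -/
theorem exists_perm_of_focalPolynomial_eq {k l : ι → ℝ}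
    (h : focalPolynomial k = focalPolynomial l) : ∃ σ : Equiv.Perm ι, l ∘ σ = k := by
  have hX : ∏ i, (X - C (k i)) = ∏ i, (X - C (l i)) := by
    refine eq_of_infinite_eval_eq _ _ ((Set.finite_singleton (0 : ℝ)).infinite_compl.mono ?_)
    intro y hy
    have hy : y ≠ 0 := hy
    have key : ∀ m : ι → ℝ, (∏ i, (X - C (m i))).eval y =
        y ^ Fintype.card ι * (focalPolynomial m).eval y⁻¹ := by
      intro m
      rw [eval_focalPolynomial, eval_prod, Fintype.card, ← Finset.prod_const,
        ← Finset.prod_mul_distrib]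
      refine Finset.prod_congr rfl fun i _ => ?_
      simp only [eval_sub, eval_X, eval_C]
      field_simp
    simp only [Set.mem_ofPred_eq, key, h]
  have hroots := congrArg roots hX
  have hr : ∀ m : ι → ℝ, (∏ i, (X - C (m i))).roots = Finset.univ.val.map m := by
    intro m
    have := roots_multiset_prod_X_sub_C (Finset.univ.val.map m)
    rwa [Multiset.map_map] at this
  rw [hr, hr] at hroots
  exact exists_perm_of_map_univ_eq hroots

/-- Two families of real numbers for which the sums `∑ k i / (1 - k i r)` agree for a set of
parameters `r` accumulating at `0` agree up to order. -/
theorem exists_perm_of_sum_div_eq {k l : ι → ℝ}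
    (h : ∃ᶠ r in nhdsWithin (0 : ℝ) {0}ᶜ,
      ∑ i, k i / (1 - k i * r) = ∑ i, l i / (1 - l i * r)) :
    ∃ σ : Equiv.Perm ι, l ∘ σ = k := by
  have hne : ∀ m : ι → ℝ, ∀ᶠ r in nhdsWithin (0 : ℝ) {0}ᶜ, ∀ i, 1 - m i * r ≠ 0 := by
    intro m
    refine Filter.Eventually.filter_mono nhdsWithin_le_nhds (Filter.eventually_all.2 fun i => ?_)
    exact (by fun_prop : ContinuousAt (fun r : ℝ => 1 - m i * r) 0).eventually_ne (by simp)
  have hQ : derivative (focalPolynomial k) * focalPolynomial l -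
      derivative (focalPolynomial l) * focalPolynomial k = 0 := by
    by_contra hQ
    have hfin := finite_setOfPred_isRoot hQ
    have hev : ∀ᶠ r in nhdsWithin (0 : ℝ) {0}ᶜ, r ∉ {r | (derivative (focalPolynomial k) *
        focalPolynomial l - derivative (focalPolynomial l) * focalPolynomial k).IsRoot r} := by
      have h1 := (hfin.subset Set.sdiff_subset : Set.Finite (_ \ {(0 : ℝ)})).isClosed.isOpen_compl
      have h2 := h1.mem_nhds (x := 0) (by simp)
      filter_upwards [nhdsWithin_le_nhds h2, self_mem_nhdsWithin] with r hr hr0 hroot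
      exact hr ⟨hroot, hr0⟩
    obtain ⟨r, hr, hroot, hrk, hrl⟩ := (h.and_eventually (hev.and ((hne k).and (hne l)))).exists
    refine hroot ?_
    simp only [Set.mem_ofPred_eq, IsRoot, eval_sub, eval_mul, eval_derivative_focalPolynomial k hrk,
      eval_derivative_focalPolynomial l hrl, eval_focalPolynomial, hr]
    ring
  refine exists_perm_of_focalPolynomial_eq (sub_eq_zero.1 ?_)
  refine eq_zero_of_derivative_mul_eq (p := focalPolynomial l) (a := 0) ?_ ?_ ?_
  -- The equation for `P_k - P_l` is `hQ` with `P_l' P_l` subtracted from both sides.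
  · rw [derivative_sub]
    linear_combination hQ
  · simp [IsRoot, eval_focalPolynomial]
  · simp [IsRoot, eval_focalPolynomial]

end Polynomials

namespace SpaceForm

/-! ### A non-minimal flow by parallels is isoparametric. -/

section Converse

variable {κ : SignType} {n : ℕ} {M : Type*} [TopologicalSpace M]
  [ChartedSpace (EuclideanSpace ℝ (Fin n)) M] {F N : M → Ambient κ n}

theorem parallelCurvature_zero (k : ℝ) : parallelCurvature κ k 0 = k := by
  simp [parallelCurvature, c_zero, s_zero]

/-- Isolates the dependence on `k`: the factor `1 / c²`, equal to `1 + κ (s/c)²`, and the last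
summand are the same for all `k`, so they cancel when two sums are compared. -/
theorem parallelCurvature_eq {k ξ : ℝ} (hc : c κ ξ ≠ 0) (hk : c κ ξ - k * s κ ξ ≠ 0) :
    parallelCurvature κ k ξ =
      k / (1 - k * (s κ ξ / c κ ξ)) * (1 / (c κ ξ * c κ ξ)) + κ * (s κ ξ / c κ ξ) := by
  have h1 : 1 - k * (s κ ξ / c κ ξ) = (c κ ξ - k * s κ ξ) / c κ ξ := by field_simp
  rw [parallelCurvature, h1]
  field_simp
  linear_combination k * c_sq_add_s_sq (κ := κ) ξ

theorem sum_div_eq_of_sum_parallelCurvature_eq {ι : Type*} [Fintype ι] {k l : ι → ℝ} {ξ : ℝ}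
    (hc : c κ ξ ≠ 0) (hk : ∀ i, c κ ξ - k i * s κ ξ ≠ 0) (hl : ∀ i, c κ ξ - l i * s κ ξ ≠ 0)
    (h : ∑ i, parallelCurvature κ (k i) ξ = ∑ i, parallelCurvature κ (l i) ξ) :
    ∑ i, k i / (1 - k i * (s κ ξ / c κ ξ)) = ∑ i, l i / (1 - l i * (s κ ξ / c κ ξ)) := by
  simp only [parallelCurvature_eq hc (hk _), parallelCurvature_eq hc (hl _),
    Finset.sum_add_distrib, ← Finset.sum_mul, add_left_inj] at h
  exact mul_right_cancel₀ (one_div_ne_zero (mul_ne_zero hc hc)) h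

theorem HasPrincipalCurvatures.comp_perm {x : M} {k : Fin n → ℝ}
    (h : HasPrincipalCurvatures F N x k) (σ : Equiv.Perm (Fin n)) :
    HasPrincipalCurvatures F N x (k ∘ σ) := by
  obtain ⟨e, he, hk⟩ := h
  exact ⟨e ∘ σ, fun i j => by simp [he], fun i j => by simp [hk]⟩

/-- No diagonalization is needed: the mean curvature at time `0` already comes with a principal
frame, for a normal equal to `N` up to sign. -/
theorem IsMCFSolution.hasPrincipalCurvatures_initial {I : Set ℝ} {G : ℝ → M → Ambient κ n}
    (hF : IsHypersurface F) (hN : IsUnitNormal F N) (h : IsMCFSolution F I G) (x : M) :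
    ∃ k, HasPrincipalCurvatures F N x k := by
  obtain ⟨ν, hν, hev⟩ := h.evolution 0 h.zero_mem
  rw [h.initial] at hν hev
  have hframe : ∀ y, ∃ k, HasPrincipalCurvatures F ν y k := by
    intro y
    obtain ⟨_, ⟨k, hk, -⟩, -⟩ := hev y
    exact ⟨k, hk⟩
  obtain ⟨ε, -, -, hε⟩ := HasPrincipalCurvatures.exists_sign hF hν hN hframe x
  obtain ⟨k, hk⟩ := hframe x
  exact ⟨_, hε k hk⟩

/-- The speed of a mean curvature flow does not depend on the choice of the unit normal. -/
theorem IsMCFSolution.hasDerivWithinAt {I : Set ℝ} {G : ℝ → M → Ambient κ n}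
    (h : IsMCFSolution F I G) {t : ℝ} (ht : t ∈ I) {ν : M → Ambient κ n}
    (hν : IsUnitNormal (G t) ν) {x : M} {H : ℝ} (hH : HasMeanCurvature (G t) ν x H) :
    HasDerivWithinAt (fun r => G r x) (H • ν x) I t := by
  obtain ⟨μ, hμ, hev⟩ := h.evolution t ht
  obtain ⟨ε, -, hμν, hε⟩ := HasPrincipalCurvatures.exists_sign (h.hypersurface t ht) hμ hν
    (fun y => by
      obtain ⟨_, ⟨k, hk, -⟩, -⟩ := hev y
      exact ⟨k, hk⟩) x
  obtain ⟨_, ⟨k, hk, rfl⟩, hder⟩ := hev x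
  have hH' : HasMeanCurvature (G t) ν x (∑ i, ε * k i) := ⟨_, hε k hk, rfl⟩
  rw [hH.unique hH', ← Finset.mul_sum, mul_comm, mul_smul, ← hμν]
  exact hder

theorem IsInitialDataOfParallelMCF.isIsoparametric [Nonempty M] (hF : IsHypersurface F)
    (hN : IsUnitNormal F N) (hmin : ¬IsMinimal F N) (h : IsInitialDataOfParallelMCF F N) :
    IsIsoparametric F N := by
  obtain ⟨I, G, ξ, hsol, hξ0, hG⟩ := h
  have hGt : ∀ t ∈ I, G t = parallel F N (ξ t) := fun t ht => funext (hG t ht)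
  choose k hk using hsol.hasPrincipalCurvatures_initial hF hN
  have hreg : ∀ t ∈ I, ∀ x i, c κ (ξ t) - k x i * s κ (ξ t) ≠ 0 := fun t ht x =>
    ((hk x).parallel_injective_iff hF hN).1 (hGt t ht ▸ (hsol.hypersurface t ht).immersion x)
  have hder : ∀ t ∈ I, ∀ x, HasDerivWithinAt (fun r => G r x)
      ((∑ i, parallelCurvature κ (k x i) (ξ t)) • parallelNormal F N (ξ t) x) I t := by
    intro t ht x
    refine hsol.hasDerivWithinAt ht ?_ ?_
    · rw [hGt t ht]; exact isUnitNormal_parallelNormal hF hN _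
    · rw [hGt t ht]; exact ⟨_, (hk x).parallel hF hN (hreg t ht x), rfl⟩
  have hders : ∀ t ∈ I, ∀ x, HasDerivWithinAt (fun r => s κ (ξ r))
      ((∑ i, parallelCurvature κ (k x i) (ξ t)) * c κ (ξ t)) I t := by
    intro t ht x
    have h1 := ((formL κ n).flip (N x)).hasFDerivAt.comp_hasDerivWithinAt t (hder t ht x)
    have h2 : ∀ r ∈ I, s κ (ξ r) =
        ((formL κ n).flip (N x)) (G r x) - form κ (F x) (N x) := by
      intro r hr
      rw [ContinuousLinearMap.flip_apply, formL_apply, hGt r hr, form_parallel_normal hN]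
      by_cases hκ : κ = 0
      · rw [c_eq_one_of_eq_zero hκ]; ring
      · rw [form_comm, hN.tangent hκ]; ring
    refine ((h1.sub_const (form κ (F x) (N x))).congr h2 (h2 t ht)).congr_deriv ?_
    rw [ContinuousLinearMap.flip_apply, formL_apply, form_smul_left,
      form_parallelNormal_normal hN]
  have hconv : Convex ℝ I := hsol.interval.convex
  have huniq : UniqueDiffOn ℝ I :=
    uniqueDiffOn_convex hconv (hconv.nontrivial_iff_nonempty_interior.1 hsol.nondegenerate)
  have hsum : ∀ t ∈ I, c κ (ξ t) ≠ 0 → ∀ x y,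
      ∑ i, parallelCurvature κ (k x i) (ξ t) = ∑ i, parallelCurvature κ (k y i) (ξ t) :=
    fun t ht hc x y => mul_right_cancel₀ hc
      ((huniq t ht).eq_deriv I (hders t ht x) (hders t ht y))
  -- At `t = 0` the mean curvature is the same at all points, so being nonzero somewhere makes it
  -- nonzero everywhere.
  have hsum0 : ∀ x, ∑ i, k x i ≠ 0 := by
    obtain ⟨y, hy⟩ := not_forall.1 hmin
    intro x hx
    refine hy ⟨k y, hk y, ?_⟩
    have := hsum 0 hsol.zero_mem (by simp [hξ0, c_zero]) x y
    simp only [hξ0, parallelCurvature_zero] at this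
    rw [← this, hx]
  obtain ⟨x₀⟩ := ‹Nonempty M›
  have hs0 : Filter.Tendsto (fun t => s κ (ξ t)) (nhdsWithin 0 I) (nhds 0) := by
    have := (hders 0 hsol.zero_mem x₀).continuousWithinAt.tendsto
    simpa only [hξ0, s_zero] using this
  have hc1 : Filter.Tendsto (fun t => c κ (ξ t)) (nhdsWithin 0 I) (nhds 1) := by
    by_cases hκ : κ = 0
    · simpa only [c_eq_one_of_eq_zero hκ] using tendsto_const_nhds
    · have h1 : ContinuousWithinAt (fun t => (κ : ℝ) * ((formL κ n).flip (F x₀)) (G t x₀)) I 0 :=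
        continuousWithinAt_const.mul (((formL κ n).flip (F x₀)).continuous.continuousAt
          |>.comp_continuousWithinAt (hder 0 hsol.zero_mem x₀).continuousWithinAt)
      have h2 : ∀ t ∈ I, (κ : ℝ) * ((formL κ n).flip (F x₀)) (G t x₀) = c κ (ξ t) := by
        intro t ht
        rw [ContinuousLinearMap.flip_apply, formL_apply, hGt t ht,
          form_parallel_position hF hN hκ, ← mul_assoc, cast_mul_self_of_ne_zero hκ, one_mul]
      have h3 := h1.tendsto
      rw [h2 0 hsol.zero_mem, hξ0, c_zero] at h3
      exact h3.congr' (by filter_upwards [self_mem_nhdsWithin] with t ht using h2 t ht)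
  have hle : nhdsWithin (0 : ℝ) (I \ {0}) ≤ nhdsWithin 0 I :=
    nhdsWithin_mono _ Set.sdiff_subset
  have hcne : ∀ᶠ t in nhdsWithin (0 : ℝ) (I \ {0}), c κ (ξ t) ≠ 0 :=
    hle (hc1.eventually_ne one_ne_zero)
  -- The derivative of `s ∘ ξ` at `0` is the initial mean curvature at `x₀`, which is nonzero.
  have hsne : ∀ᶠ t in nhdsWithin (0 : ℝ) (I \ {0}), s κ (ξ t) ≠ 0 :=
    (hders 0 hsol.zero_mem x₀).eventually_ne
      (by simpa only [hξ0, parallelCurvature_zero, c_zero, mul_one] using hsum0 x₀)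
  have hτ : Filter.Tendsto (fun t => s κ (ξ t) / c κ (ξ t)) (nhdsWithin (0 : ℝ) (I \ {0}))
      (nhdsWithin 0 {0}ᶜ) := by
    refine tendsto_nhdsWithin_iff.2 ⟨?_, ?_⟩
    · have := (hs0.div hc1 one_ne_zero).mono_left hle
      rwa [zero_div] at this
    · filter_upwards [hcne, hsne] with t h1 h2 using div_ne_zero h2 h1
  -- `0` is an accumulation point of `I` even when it is an endpoint; this turns "eventually" into
  -- "frequently" below.
  have hne : (nhdsWithin (0 : ℝ) (I \ {0})).NeBot := by
    have := uniqueDiffWithinAt_iff_accPt.1 (huniq 0 hsol.zero_mem)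
    rwa [accPt_principal_iff_nhdsWithin] at this
  refine ⟨k x₀, fun x => ?_⟩
  obtain ⟨σ, hσ⟩ := exists_perm_of_sum_div_eq (k := k x₀) (l := k x) (hτ.frequently (by
    refine Filter.Eventually.frequently ?_
    filter_upwards [hcne, self_mem_nhdsWithin] with t hc ht
    exact sum_div_eq_of_sum_parallelCurvature_eq hc (hreg t ht.1 x₀) (hreg t ht.1 x)
      (hsum t ht.1 hc x₀ x)))
  rw [← hσ]
  exact (hk x).comp_perm σ

end Converse

end SpaceForm

end

theorem theorem2p1 {κ : SignType} {n : ℕ} {M : Type*} [TopologicalSpace M] [ConnectedSpace M]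
    [ChartedSpace (EuclideanSpace ℝ (Fin n)) M] [IsManifold (𝓡 n) ∞ M]
    (F N : M → SpaceForm.Ambient κ n)
    (hF : SpaceForm.IsHypersurface F) (hN : SpaceForm.IsUnitNormal F N) :
    (SpaceForm.IsIsoparametric F N → SpaceForm.IsInitialDataOfParallelMCF F N) ∧
    (¬ SpaceForm.IsMinimal F N → SpaceForm.IsInitialDataOfParallelMCF F N →
      SpaceForm.IsIsoparametric F N) :=
  ⟨fun h => h.isInitialDataOfParallelMCF hF hN, fun hmin h => h.isIsoparametric hF hN hmin⟩
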